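/- Let $X$ be a metric space and let $k>0$ be an integer. Let $\mathcal{E}^kX$ be the space of unordered $k$-tuples of points of $X$, that is, the set of all empirical measures $\frac1k\sum_{i=1}^k\delta_{x_i}$ with $x_1,\dots,x_k\in X$, endowed with the $1$-Wasserstein distance $$W_1(\alpha,\beta)=\inf_{\gamma}\int_{X\times X}d(x,y)\,d\gamma(x,y),$$ where $\gamma$ ranges over all Borel measures on $X\times X$ with marginals $\alpha$ and $\beta$. If $X$ coarsely embeds into a (real) Hilbert space, then $\mathcal{E}^kX$ coarsely embeds into a (real) Hilbert space. Here a map $f\colon Y\to Z$ between metric spaces is a coarse embedding if there are non-decreasing functions $\rho_-,\rho_+\colon[0,\infty)\to[0,\infty)$ with $\lim_{t\to\infty}\rho_-(t)=\infty$ and $$\rho_-(d(y,y'))\le d(f(y),f(y'))\le\rho_+(d(y,y'))\qquad\text{for all } y,y'\in Y,$$ and a space coarsely embeds into a Hilbert space if there is a coarse embedding of it into some Hilbert space, not necessarily separable. -/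

import Mathlib

open MeasureTheory Filter
open scoped ENNReal

universe u v

section Wasserstein

variable {X : Type u} [MetricSpace X] [MeasurableSpace X] [BorelSpace X]

/-- `γ` is a coupling of `α` and `β`: a Borel measure on `X × X` with marginals `α` and `β`.
The σ-algebra on `X × X` is the Borel one, which may be strictly finer than the product σ-algebra
if `X` is not separable. -/
def IsCoupling (γ : @Measure (X × X) (borel (X × X))) (α β : Measure X) : Prop :=
  @Measure.map (X × X) X (borel (X × X)) _ Prod.fst γ = α ∧
    @Measure.map (X × X) X (borel (X × X)) _ Prod.snd γ = β

/-- The transport cost `∫ d(x, y) dγ(x, y)`. -/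
noncomputable def transportCost (γ : @Measure (X × X) (borel (X × X))) : ℝ≥0∞ :=
  @lintegral (X × X) (borel (X × X)) γ (fun p => edist p.1 p.2)

/-- The `1`-Wasserstein distance: the infimum of the transport costs of all couplings
(a real number if `α` and `β` are probability measures with finite first moment). -/
noncomputable def wassersteinOne (α β : Measure X) : ℝ :=
  (⨅ (γ : @Measure (X × X) (borel (X × X))) (_ : IsCoupling γ α β), transportCost γ).toReal

/-- The empirical measure `(1/k) ∑ᵢ δ_{xᵢ}`. -/
noncomputable def empiricalMeasure {k : ℕ} (x : Fin k → X) : Measure X :=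
  (k : ℝ≥0∞)⁻¹ • ∑ i, Measure.dirac (x i)

variable (k : ℕ) (X) in
/-- The set of all empirical measures of size `k` on `X`. -/
def EmpiricalSpace : Type u :=
  {α : Measure X // ∃ x : Fin k → X, α = empiricalMeasure x}

/-- Empirical measures of size `k` carry the `1`-Wasserstein distance. -/
noncomputable instance EmpiricalSpace.instDist (k : ℕ) : Dist (EmpiricalSpace X k) :=
  ⟨fun α β => wassersteinOne α.1 β.1⟩

end Wasserstein

/-- `f` is a coarse embedding, with control functions `ρ₁, ρ₂ : [0, ∞) → [0, ∞)` (only their values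
on `[0, ∞)` matter). The definition involves nothing but the two distance functions. -/
def IsCoarseEmbedding {X : Type u} {Y : Type v} [Dist X] [Dist Y] (f : X → Y) : Prop :=
  ∃ ρ₁ ρ₂ : ℝ → ℝ,
    MonotoneOn ρ₁ (Set.Ici 0) ∧ MonotoneOn ρ₂ (Set.Ici 0) ∧
    (∀ t, 0 ≤ t → 0 ≤ ρ₁ t) ∧ (∀ t, 0 ≤ t → 0 ≤ ρ₂ t) ∧
    Tendsto ρ₁ atTop atTop ∧
    ∀ x x' : X, ρ₁ (dist x x') ≤ dist (f x) (f x') ∧ dist (f x) (f x') ≤ ρ₂ (dist x x')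

/-- `X` coarsely embeds into some real Hilbert space (of universe level `v`). -/
def CoarselyEmbedsIntoHilbert (X : Type u) [Dist X] : Prop :=
  ∃ (H : Type v) (_ : NormedAddCommGroup H) (_ : InnerProductSpace ℝ H) (_ : CompleteSpace H)
    (f : X → H), IsCoarseEmbedding f

/-! Let `f` embed `X` coarsely into a Hilbert space. The Gaussian kernels `exp (-t ‖f a - f b‖²)`
are positive semidefinite, hence inner products of unit vectors `φ n a`. Parameters `t n` and scales
`T n` are chosen so that the kernel is within `ε n` of 1 at distances up to `T n` and at most `ε n`
from `T (n + 1)` on. A measure with atoms `x i` is sent to the sums `∑ i, φ n (x i)`, one for each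
`n`, assembled in a Hilbert sum.

Upper bound: if `W₁` is small, Hall's theorem matches the two tuples with small displacement
(`exists_perm_of_coupling`). All large scales then contribute `O(ε n)`, which is summable, and each
of the finitely many others is bounded.

Lower bound: if `W₁` is large, no matching exists at many scales. The `2k` points have at most
`(2k)²` distances, so all but boundedly many scales have none in `[T n, T (n + 1))`. At such a scale
the points fall into clusters, one of them unbalanced, and the contribution is at least `1/4`
(`half_le_norm_sum_sub_sum`). -/

/-! ### Positive semidefinite kernels and their feature maps. -/

section Kernels

open Matrix
open scoped InnerProductSpace

theorem Matrix.PosSemidef.of_tendsto {n : Type*} {A : ℕ → Matrix n n ℝ} {B : Matrix n n ℝ}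
    (hA : ∀ m, (A m).PosSemidef) (h : ∀ i j, Tendsto (fun m => A m i j) atTop (nhds (B i j))) :
    B.PosSemidef := by
  refine ⟨?_, fun x => ?_⟩
  · ext i j
    refine tendsto_nhds_unique (h j i) ?_
    have : (fun m => A m j i) = fun m => A m i j := by
      funext m
      simpa using (hA m).isHermitian.apply i j
    rw [this]
    exact h i j
  · refine ge_of_tendsto' (x := atTop)
      (f := fun m => x.sum fun i xi => x.sum fun j xj => star xi * A m i j * xj)
      ?_ fun m => (hA m).2 x
    simp only [Finsupp.sum]
    exact tendsto_finsetSum _ fun i _ => tendsto_finsetSum _ fun j _ =>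
      ((h i j).const_mul _).mul_const _

theorem posSemidef_of_inner {n E : Type*} [NormedAddCommGroup E] [InnerProductSpace ℝ E]
    (f : n → E) : (Matrix.of fun i j => ⟪f i, f j⟫_ℝ).PosSemidef := by
  refine ⟨?_, fun x => ?_⟩
  · ext i j
    simp [real_inner_comm]
  · have h := real_inner_self_nonneg (x := x.sum fun i c => c • f i)
    simp only [Finsupp.sum, sum_inner, inner_sum, real_inner_smul_left, real_inner_smul_right] at h ⊢
    refine h.trans_eq ?_
    refine Finset.sum_congr rfl fun i _ => ?_
    refine Finset.sum_congr rfl fun j _ => ?_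
    simp only [star_trivial, Matrix.of_apply, real_inner_comm (f i) (f j)]
    ring

theorem Matrix.PosSemidef.map_pow {n : Type*} {A : Matrix n n ℝ} (hA : A.PosSemidef) (m : ℕ) :
    (Matrix.of fun i j => A i j ^ m).PosSemidef := by
  induction m with
  | zero =>
    have h : (Matrix.of fun i j => A i j ^ 0) = Matrix.of fun _ _ : n => ⟪(1 : ℝ), 1⟫_ℝ := by
      ext i j
      simp
    rw [h]
    exact posSemidef_of_inner _
  | succ m ih =>
    exact ih.hadamard hA

/-- Partial sums of the exponential series are nonnegative combinations of Hadamard powers, which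
are positive semidefinite by Schur's product theorem. -/
theorem Matrix.PosSemidef.map_exp {n : Type*} {A : Matrix n n ℝ} (hA : A.PosSemidef) :
    (Matrix.of fun i j => Real.exp (A i j)).PosSemidef := by
  refine Matrix.PosSemidef.of_tendsto
    (A := fun m => ∑ l ∈ Finset.range m, ((l.factorial : ℝ)⁻¹) • Matrix.of fun i j => A i j ^ l)
    (fun m => posSemidef_sum _ fun l _ => (hA.map_pow l).smul (by positivity)) fun i j => ?_
  have h := (NormedSpace.expSeries_div_hasSum_exp (A i j)).tendsto_sum_nat
  rw [← Real.exp_eq_exp_ℝ] at h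
  simpa [Matrix.sum_apply, div_eq_inv_mul] using h

/-- Expanding the square factors the kernel as `exp (2t⟪u, v⟫)` times the rank-one kernel `exp
(-t‖u‖²) exp (-t‖v‖²)`. -/
theorem posSemidef_gaussian {X : Type u} {H : Type v} [NormedAddCommGroup H]
    [InnerProductSpace ℝ H] (f : X → H) {t : ℝ} (ht : 0 ≤ t) :
    (Matrix.of fun x y => Real.exp (-(t * ‖f x - f y‖ ^ 2))).PosSemidef := by
  have h₁ := ((posSemidef_of_inner f).smul (a := 2 * t) (by positivity)).map_exp
  have h₂ := posSemidef_of_inner (fun x => Real.exp (-(t * ‖f x‖ ^ 2)))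
  have h : (Matrix.of fun x y => Real.exp (-(t * ‖f x - f y‖ ^ 2))) =
      (Matrix.of fun i j => Real.exp (((2 * t) • Matrix.of fun i j => ⟪f i, f j⟫_ℝ) i j)) ⊙
        Matrix.of fun i j => ⟪Real.exp (-(t * ‖f i‖ ^ 2)), Real.exp (-(t * ‖f j‖ ^ 2))⟫_ℝ := by
    ext x y
    simp only [of_apply, hadamard_apply, Matrix.smul_apply, smul_eq_mul, RCLike.inner_apply, conj_trivial]
    rw [← Real.exp_add, ← Real.exp_add, norm_sub_sq_real]
    ring_nf
  rw [h]
  exact h₁.hadamard h₂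

/-- Moore's theorem for real kernels. -/
theorem Matrix.PosSemidef.exists_inner_eq {X : Type u} {k : Matrix X X ℝ} (hk : k.PosSemidef) :
    ∃ (E : Type u) (_ : NormedAddCommGroup E) (_ : InnerProductSpace ℝ E) (_ : CompleteSpace E)
      (φ : X → E), ∀ x y, ⟪φ x, φ y⟫_ℝ = k x y := by
  -- Scalars become multiplication operators on `ℝ`, giving an operator-valued kernel; the feature
  -- vector of `x` is its kernel function applied to `1`.
  let K : Matrix X X (ℝ →L[ℝ] ℝ) := Matrix.of fun x y => k x y • ContinuousLinearMap.id ℝ ℝ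
  have hsymm : ∀ x y, k x y = k y x := fun x y => by simpa using hk.isHermitian.apply y x
  have hK : K.PosSemidef := by
    have htfae := (RKHS.posSemidef_tfae (K := K)).out 0 2
    refine htfae.mpr ⟨?_, fun x => ?_⟩
    · ext x y
      have hone : ContinuousLinearMap.adjoint (ContinuousLinearMap.id ℝ ℝ) =
          ContinuousLinearMap.id ℝ ℝ := ContinuousLinearMap.adjoint_id
      simp [K, Matrix.conjTranspose_apply, hsymm x y, ContinuousLinearMap.star_eq_adjoint, hone]
    · have h := hk.2 x
      simp only [Finsupp.sum] at h ⊢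
      refine h.trans_eq ?_
      refine Finset.sum_congr rfl fun i _ => ?_
      refine Finset.sum_congr rfl fun j _ => ?_
      simp [K, hsymm i j]
      ring
  have : Fact K.PosSemidef := ⟨hK⟩
  refine ⟨RKHS.OfKernel K, inferInstance, inferInstance, inferInstance,
    fun x => RKHS.kerFun (RKHS.OfKernel K) x 1, fun x y => ?_⟩
  rw [← RKHS.kernel_inner, RKHS.OfKernel.kernel_ofKernel]
  simp [K, hsymm x y]

end Kernels

/-! ### Wasserstein distance and matchings. -/

section Transport

theorem map_smul_sum_dirac {ι Z W : Type*} [Fintype ι] [MeasurableSpace Z] [MeasurableSpace W]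
    {g : Z → W} (hg : Measurable g) (c : ℝ≥0∞) (z : ι → Z) :
    (c • ∑ i, Measure.dirac (z i)).map g = c • ∑ i, Measure.dirac (g (z i)) := by
  rw [Measure.map_smul, ← Measure.mapₗ_apply_of_measurable hg, map_sum]
  simp [Measure.mapₗ_apply_of_measurable hg, Measure.map_dirac' hg]

theorem empiricalMeasure_apply {X : Type u} [MeasurableSpace X] {k : ℕ} (x : Fin k → X)
    {s : Set X} (hs : MeasurableSet s) [DecidablePred (· ∈ s)] :
    empiricalMeasure x s = (k : ℝ≥0∞)⁻¹ * (Finset.univ.filter fun i => x i ∈ s).card := by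
  classical
  rw [empiricalMeasure, Measure.smul_apply, Measure.finsetSum_apply, smul_eq_mul]
  simp [Measure.dirac_apply' _ hs, Set.indicator_apply]

theorem empiricalMeasure_comp_perm {X : Type u} [MeasurableSpace X] {k : ℕ}
    (x : Fin k → X) (σ : Equiv.Perm (Fin k)) :
    empiricalMeasure (x ∘ σ) = empiricalMeasure x := by
  simp only [empiricalMeasure, Function.comp_apply]
  rw [Equiv.sum_comp σ fun i => Measure.dirac (x i)]

theorem measurable_edist_borel {X : Type u} [MetricSpace X] :
    @Measurable (X × X) ℝ≥0∞ (borel (X × X)) _ fun p => edist p.1 p.2 :=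
  letI : MeasurableSpace (X × X) := borel (X × X)
  haveI : BorelSpace (X × X) := ⟨rfl⟩
  continuous_edist.measurable

variable {X : Type u} [MetricSpace X] [MeasurableSpace X] [BorelSpace X]

theorem measurable_fst_borel : @Measurable (X × X) X (borel (X × X)) _ Prod.fst :=
  letI : MeasurableSpace (X × X) := borel (X × X)
  haveI : BorelSpace (X × X) := ⟨rfl⟩
  continuous_fst.measurable

theorem measurable_snd_borel : @Measurable (X × X) X (borel (X × X)) _ Prod.snd :=
  letI : MeasurableSpace (X × X) := borel (X × X)
  haveI : BorelSpace (X × X) := ⟨rfl⟩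
  continuous_snd.measurable

theorem iInf_transportCost_le {k : ℕ} (x y : Fin k → X) (σ : Equiv.Perm (Fin k)) :
    (⨅ (γ : @Measure (X × X) (borel (X × X)))
      (_ : IsCoupling γ (empiricalMeasure x) (empiricalMeasure y)), transportCost γ) ≤
      (k : ℝ≥0∞)⁻¹ * ∑ i, edist (x i) (y (σ i)) := by
  let : MeasurableSpace (X × X) := borel (X × X)
  refine iInf₂_le_of_le ((k : ℝ≥0∞)⁻¹ • ∑ i, Measure.dirac (x i, y (σ i))) ⟨?_, ?_⟩ ?_
  · exact map_smul_sum_dirac measurable_fst_borel _ _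
  · rw [← empiricalMeasure_comp_perm y σ]
    exact map_smul_sum_dirac measurable_snd_borel _ _
  · rw [transportCost, lintegral_smul_measure, lintegral_finsetSum_measure]
    simp [lintegral_dirac' _ measurable_edist_borel]

theorem wassersteinOne_le_of_perm {k : ℕ} (x y : Fin k → X) (σ : Equiv.Perm (Fin k)) {t : ℝ}
    (ht : 0 ≤ t) (h : ∀ i, dist (x i) (y (σ i)) ≤ t) :
    wassersteinOne (empiricalMeasure x) (empiricalMeasure y) ≤ t := by
  refine ENNReal.toReal_le_of_le_ofReal ht ((iInf_transportCost_le x y σ).trans ?_)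
  calc (k : ℝ≥0∞)⁻¹ * ∑ i, edist (x i) (y (σ i))
      ≤ (k : ℝ≥0∞)⁻¹ * ∑ _i : Fin k, ENNReal.ofReal t := by
        gcongr with i
        rw [edist_dist]
        exact ENNReal.ofReal_le_ofReal (h i)
    _ = (k : ℝ≥0∞)⁻¹ * k * ENNReal.ofReal t := by simp [mul_assoc]
    _ ≤ 1 * ENNReal.ofReal t := by
        gcongr
        exact ENNReal.inv_mul_le_one _
    _ = ENNReal.ofReal t := one_mul _

/-- Markov's inequality and Hall's marriage theorem turn a cheap coupling into a matching. -/
theorem exists_perm_of_coupling {k : ℕ} (hk : 0 < k) (x y : Fin k → X) {t : ℝ} 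
    (γ : @Measure (X × X) (borel (X × X)))
    (hγ : IsCoupling γ (empiricalMeasure x) (empiricalMeasure y))
    (hcost : transportCost γ < ENNReal.ofReal (t / k)) :
    ∃ σ : Equiv.Perm (Fin k), ∀ i, dist (x i) (y (σ i)) < t := by
  classical
  let : MeasurableSpace (X × X) := borel (X × X)
  have hk0 : (k : ℝ≥0∞) ≠ 0 := by exact_mod_cast hk.ne'
  have hkt : (k : ℝ≥0∞) ≠ ⊤ := ENNReal.natCast_ne_top k
  -- The mass moved by at least `t` is less than that of a single atom.
  have hfar : γ {p | ENNReal.ofReal t ≤ edist p.1 p.2} < (k : ℝ≥0∞)⁻¹ := by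
    have h := (mul_meas_ge_le_lintegral (μ := γ) measurable_edist_borel
      (ENNReal.ofReal t)).trans_lt hcost
    rw [ENNReal.ofReal_div_of_pos (by exact_mod_cast hk), ENNReal.ofReal_natCast,
      div_eq_mul_inv] at h
    exact lt_of_mul_lt_mul_left' h
  let N : Fin k → Finset (Fin k) := fun i => Finset.univ.filter fun j => dist (x i) (y j) < t
  -- Hall's condition: mass at least `|A| / k` starts in `x '' A`. Up to a null set it ends at the
  -- neighbours of `A` or moves by at least `t`, so `|A| < |N(A)| + 1`.
  have hall : ∀ A : Finset (Fin k), A.card ≤ (A.biUnion N).card := by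
    intro A
    let B : Set X := x '' A
    let D : Set X := y '' (A.biUnion N)
    have hB : MeasurableSet B := (A.finite_toSet.image x).measurableSet
    have hD : MeasurableSet D := ((A.biUnion N).finite_toSet.image y).measurableSet
    have hR : MeasurableSet (Set.range y) := (Set.finite_range y).measurableSet
    have h₁ : (k : ℝ≥0∞)⁻¹ * A.card ≤ γ (Prod.fst ⁻¹' B) := by
      rw [← Measure.map_apply measurable_fst_borel hB, hγ.1, empiricalMeasure_apply x hB]
      gcongr
      intro i hi
      simpa using ⟨i, hi, rfl⟩
    have h₂ : γ (Prod.snd ⁻¹' D) ≤ (k : ℝ≥0∞)⁻¹ * (A.biUnion N).card := by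
      rw [← Measure.map_apply measurable_snd_borel hD, hγ.2, empiricalMeasure_apply y hD]
      gcongr
      intro j hj
      obtain ⟨j', hj', hjj⟩ := (Finset.mem_filter.mp hj).2
      rw [Finset.mem_coe, Finset.mem_biUnion] at hj'
      obtain ⟨i, hi, hij⟩ := hj'
      refine Finset.mem_biUnion.mpr ⟨i, hi, ?_⟩
      simpa [N, hjj] using hij
    have h₃ : γ (Prod.snd ⁻¹' (Set.range y)ᶜ) = 0 := by
      rw [← Measure.map_apply measurable_snd_borel hR.compl, hγ.2,
        empiricalMeasure_apply y hR.compl]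
      simp
    have hsub : Prod.fst ⁻¹' B ⊆ (Prod.snd ⁻¹' D ∪ Prod.snd ⁻¹' (Set.range y)ᶜ) ∪
        {p : X × X | ENNReal.ofReal t ≤ edist p.1 p.2} := by
      rintro ⟨a, b⟩ ⟨i, hi, rfl : x i = a⟩
      by_cases hb : b ∈ Set.range y
      · obtain ⟨j, rfl⟩ := hb
        by_cases hij : dist (x i) (y j) < t
        · exact Or.inl (Or.inl ⟨j, Finset.mem_biUnion.mpr ⟨i, hi, by simpa [N] using hij⟩, rfl⟩)
        · refine Or.inr ?_
          simp only [Set.mem_ofPred_eq, edist_dist]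
          exact ENNReal.ofReal_le_ofReal (not_lt.mp hij)
      · exact Or.inl (Or.inr hb)
    have h₄ : (k : ℝ≥0∞)⁻¹ * A.card < (k : ℝ≥0∞)⁻¹ * ((A.biUnion N).card + 1 : ℕ) := by
      calc (k : ℝ≥0∞)⁻¹ * A.card ≤ γ (Prod.fst ⁻¹' B) := h₁
        _ ≤ (γ (Prod.snd ⁻¹' D) + γ (Prod.snd ⁻¹' (Set.range y)ᶜ)) +
            γ {p | ENNReal.ofReal t ≤ edist p.1 p.2} :=
          (measure_mono hsub).trans ((measure_union_le _ _).trans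
            (add_le_add_left (measure_union_le _ _) _))
        _ ≤ (k : ℝ≥0∞)⁻¹ * (A.biUnion N).card + γ {p | ENNReal.ofReal t ≤ edist p.1 p.2} := by
          rw [h₃, add_zero]
          gcongr
        _ < (k : ℝ≥0∞)⁻¹ * (A.biUnion N).card + (k : ℝ≥0∞)⁻¹ := by
          refine ENNReal.add_lt_add_left ?_ hfar
          exact ENNReal.mul_ne_top (ENNReal.inv_ne_top.mpr hk0) (ENNReal.natCast_ne_top _)
        _ = _ := by push_cast; ring
    have h₅ := lt_of_mul_lt_mul_left' h₄
    exact Nat.lt_succ_iff.mp (by exact_mod_cast h₅)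
  obtain ⟨g, hg, hgN⟩ := (Finset.all_card_le_biUnion_card_iff_exists_injective N).mp hall
  refine ⟨Equiv.ofBijective g (Finite.injective_iff_bijective.mp hg), fun i => ?_⟩
  simpa [N] using hgN i

theorem exists_perm_of_wassersteinOne_lt {k : ℕ} (hk : 0 < k) (x y : Fin k → X) {t : ℝ}
    (h : wassersteinOne (empiricalMeasure x) (empiricalMeasure y) < t / k) :
    ∃ σ : Equiv.Perm (Fin k), ∀ i, dist (x i) (y (σ i)) < t := by
  -- Finiteness is needed because `toReal` sends `⊤` to `0`.
  have hfin : (⨅ (γ : @Measure (X × X) (borel (X × X)))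
      (_ : IsCoupling γ (empiricalMeasure x) (empiricalMeasure y)), transportCost γ) ≠ ⊤ := by
    refine ((iInf_transportCost_le x y 1).trans_lt ?_).ne
    refine ENNReal.mul_lt_top ?_ (ENNReal.sum_lt_top.mpr fun i _ => edist_lt_top _ _)
    rw [ENNReal.inv_lt_top]
    exact_mod_cast hk
  have h' := (ENNReal.lt_ofReal_iff_toReal_lt hfin).mpr h
  obtain ⟨γ, hγ⟩ := iInf_lt_iff.mp h'
  obtain ⟨hc, hγ⟩ := iInf_lt_iff.mp hγ
  exact exists_perm_of_coupling hk x y γ hc hγ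

end Transport

/-! ### Estimates at a single scale, and counting of bad scales. -/

section Scales

open scoped InnerProductSpace

variable {X : Type u} [MetricSpace X]

/-- At a scale `T` such that no two of the points of `x` and `y` have their distance in `[T, T')`,
"being closer than `T`" is an equivalence relation on these points, and testing against a point of
a class that contains more points of `x` than of `y`, or conversely, separates the images of the
two tuples. -/
theorem half_le_norm_sum_sub_sum {E : Type*} [NormedAddCommGroup E] [InnerProductSpace ℝ E]
    {φ : X → E} (hφ : ∀ a, ‖φ a‖ = 1) (hφ0 : ∀ a b, 0 ≤ ⟪φ a, φ b⟫_ℝ) {T T' ε : ℝ} (hT : 0 < T)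
    (hTT : 2 * T ≤ T') (hnear : ∀ a b, dist a b ≤ T → 1 - ε ≤ ⟪φ a, φ b⟫_ℝ)
    (hfar : ∀ a b, T' ≤ dist a b → ⟪φ a, φ b⟫_ℝ ≤ ε) {k : ℕ} (hε : 4 * k * ε ≤ 1)
    (x y : Fin k → X)
    (hgap : ∀ p q, dist (Sum.elim x y p) (Sum.elim x y q) < T' →
      dist (Sum.elim x y p) (Sum.elim x y q) < T)
    (hσ : ¬ ∃ σ : Equiv.Perm (Fin k), ∀ i, dist (x i) (y (σ i)) < T) :
    1 / 2 ≤ ‖∑ i, φ (x i) - ∑ i, φ (y i)‖ := by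
  classical
  let z := Sum.elim x y
  let c : Fin k ⊕ Fin k → Set (Fin k ⊕ Fin k) := fun p => {q | dist (z p) (z q) < T}
  have hc : ∀ p q, c p = c q ↔ dist (z p) (z q) < T := by
    intro p q
    constructor
    · intro h
      have : q ∈ c q := by simpa [c] using hT
      rwa [← h] at this
    · intro h
      ext r
      constructor
      · intro (hr : dist (z p) (z r) < T)
        refine hgap q r ?_
        have := dist_triangle_left (z q) (z r) (z p)
        change dist (z q) (z r) < T'
        linarith
      · intro (hr : dist (z q) (z r) < T)
        refine hgap p r ?_
        have := dist_triangle (z p) (z q) (z r)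
        change dist (z p) (z r) < T'
        linarith
  -- If every class were balanced, bijections between the fibres would assemble into a permutation
  -- excluded by `hσ`.
  obtain ⟨C, hC⟩ : ∃ C, Fintype.card {i // c (.inl i) = C} ≠ Fintype.card {i // c (.inr i) = C} := by
    by_contra! h
    let e := fun C => Fintype.equivOfCardEq (h C)
    refine hσ ⟨Equiv.ofFiberEquiv (f := fun i => c (.inl i)) (g := fun i => c (.inr i)) e,
      fun i => ?_⟩
    exact (hc (.inl i) (.inr _)).mp (Equiv.ofFiberEquiv_map e i).symm
  obtain ⟨p, rfl⟩ : ∃ p, c p = C := by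
    by_contra! h
    exact hC (by simp [h])
  rw [Fintype.card_subtype, Fintype.card_subtype] at hC
  -- Pairing with `φ (z p)` counts the members of its class with error `k * ε ≤ 1/4`. The two counts
  -- differ by at least 1, which leaves `1/2`.
  have key : ∀ w : Fin k → Fin k ⊕ Fin k,
      |∑ i, ⟪φ (z (w i)), φ (z p)⟫_ℝ - (Finset.univ.filter fun i => c (w i) = c p).card| ≤
        k * ε := by
    intro w
    rw [Finset.card_filter]
    push_cast
    rw [← Finset.sum_sub_distrib]
    refine (Finset.abs_sum_le_sum_abs _ _).trans ?_
    calc ∑ i, |⟪φ (z (w i)), φ (z p)⟫_ℝ - if c (w i) = c p then 1 else 0|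
        ≤ ∑ _i : Fin k, ε := by
          refine Finset.sum_le_sum fun i _ => ?_
          split_ifs with h
          · have h₁ := hnear _ _ ((hc _ _).mp h).le
            have h₂ := real_inner_le_norm (φ (z (w i))) (φ (z p))
            rw [hφ, hφ, one_mul] at h₂
            rw [abs_le]
            constructor <;> linarith
          · rw [hc] at h
            have h₁ := hfar _ _ (not_lt.mp fun h' => h (hgap _ _ h'))
            rwa [sub_zero, abs_of_nonneg (hφ0 _ _)]
      _ = k * ε := by simp
  have h₁ := abs_le.mp (key Sum.inl)
  have h₂ := abs_le.mp (key Sum.inr)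
  have h₃ := abs_real_inner_le_norm (∑ i, φ (x i) - ∑ i, φ (y i)) (φ (z p))
  rw [hφ, mul_one, inner_sub_left, sum_inner, sum_inner] at h₃
  refine le_trans ?_ h₃
  have hx : ∀ i, z (.inl i) = x i := fun _ => rfl
  have hy : ∀ i, z (.inr i) = y i := fun _ => rfl
  simp only [hx, hy] at h₁ h₂
  rcases lt_or_gt_of_ne hC with h | h
  · have h' : ((Finset.univ.filter fun i => c (.inl i) = c p).card : ℝ) + 1 ≤
        (Finset.univ.filter fun i => c (.inr i) = c p).card := by exact_mod_cast h
    rw [le_abs]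
    right
    linarith [h₁.2, h₂.1]
  · have h' : ((Finset.univ.filter fun i => c (.inr i) = c p).card : ℝ) + 1 ≤
        (Finset.univ.filter fun i => c (.inl i) = c p).card := by exact_mod_cast h
    rw [le_abs]
    left
    linarith [h₁.1, h₂.2]

/-- A number lies in at most one of the intervals `[T n, T (n + 1))`. -/
theorem card_filter_exists_mem_Ico_le {ι : Type*} [Fintype ι] {T : ℕ → ℝ} (hT : Monotone T)
    (d : ι → ℝ) (s : Finset ℕ) [DecidablePred fun n => ∃ i, T n ≤ d i ∧ d i < T (n + 1)] :
    (s.filter fun n => ∃ i, T n ≤ d i ∧ d i < T (n + 1)).card ≤ Fintype.card ι := by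
  classical
  rcases isEmpty_or_nonempty ι with hι | hι
  · simp
  have h : ∀ n, ∃ i, (∃ i, T n ≤ d i ∧ d i < T (n + 1)) → T n ≤ d i ∧ d i < T (n + 1) := by
    intro n
    by_cases hn : ∃ i, T n ≤ d i ∧ d i < T (n + 1)
    · obtain ⟨i, hi⟩ := hn
      exact ⟨i, fun _ => hi⟩
    · exact ⟨hι.some, fun h => absurd h hn⟩
  choose g hg using h
  refine Finset.card_le_card_of_injOn g (fun _ _ => Finset.mem_univ _) fun m hm n hn hmn => ?_
  have hm' := hg m (Finset.mem_filter.mp hm).2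
  have hn' := hg n (Finset.mem_filter.mp hn).2
  rw [hmn] at hm'
  by_contra hne
  rcases lt_or_gt_of_ne hne with h | h
  · exact absurd (hT (Nat.succ_le_of_lt h)) (not_le.mpr (hn'.1.trans_lt hm'.2))
  · exact absurd (hT (Nat.succ_le_of_lt h)) (not_le.mpr (hm'.1.trans_lt hn'.2))

/-- For unit vectors `‖φ a - φ b‖² = 2 - 2⟪φ a, φ b⟫ ≤ 2ε`; Cauchy–Schwarz sums this over the
matched pairs. -/
theorem norm_sum_sub_sum_sq_le {E : Type*} [NormedAddCommGroup E] [InnerProductSpace ℝ E]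
    {φ : X → E} (hφ : ∀ a, ‖φ a‖ = 1) {T ε : ℝ}
    (hnear : ∀ a b, dist a b ≤ T → 1 - ε ≤ ⟪φ a, φ b⟫_ℝ) {k : ℕ} (x y : Fin k → X)
    (σ : Equiv.Perm (Fin k)) (hσ : ∀ i, dist (x i) (y (σ i)) ≤ T) :
    ‖∑ i, φ (x i) - ∑ i, φ (y i)‖ ^ 2 ≤ k ^ 2 * (2 * ε) := by
  rw [← Equiv.sum_comp σ fun i => φ (y i), ← Finset.sum_sub_distrib]
  calc ‖∑ i, (φ (x i) - φ (y (σ i)))‖ ^ 2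
      ≤ (∑ i, ‖φ (x i) - φ (y (σ i))‖) ^ 2 := by
        gcongr
        exact norm_sum_le _ _
    _ ≤ (Finset.univ : Finset (Fin k)).card * ∑ i, ‖φ (x i) - φ (y (σ i))‖ ^ 2 :=
        sq_sum_le_card_mul_sum_sq
    _ ≤ k * ∑ _i : Fin k, 2 * ε := by
        rw [Finset.card_univ, Fintype.card_fin]
        gcongr with i
        rw [norm_sub_sq_real, hφ, hφ]
        linarith [hnear _ _ (hσ i)]
    _ = k ^ 2 * (2 * ε) := by
        simp
        ring

theorem norm_sum_sub_sum_sq_le_four {X : Type u} {E : Type*} [NormedAddCommGroup E]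
    {φ : X → E} (hφ : ∀ a, ‖φ a‖ = 1) {k : ℕ} (x y : Fin k → X) :
    ‖∑ i, φ (x i) - ∑ i, φ (y i)‖ ^ 2 ≤ (2 * k) ^ 2 := by
  have h : ∀ w : Fin k → X, ‖∑ i, φ (w i)‖ ≤ k := fun w =>
    (norm_sum_le _ _).trans (by simp [hφ])
  have := norm_sub_le (∑ i, φ (x i)) (∑ i, φ (y i))
  gcongr
  linarith [h x, h y]

theorem IsCoarseEmbedding.exists_gaussian_scale {H : Type v} [NormedAddCommGroup H] {f : X → H}
    (hf : IsCoarseEmbedding f) {R ε : ℝ} (hR : 0 ≤ R) (hε : 0 < ε) :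
    ∃ t S : ℝ, 0 ≤ t ∧ 2 * R ≤ S ∧
      (∀ a b, dist a b ≤ R → 1 - ε ≤ Real.exp (-(t * ‖f a - f b‖ ^ 2))) ∧
      ∀ a b, S ≤ dist a b → Real.exp (-(t * ‖f a - f b‖ ^ 2)) ≤ ε := by
  obtain ⟨ρ₁, ρ₂, hρ₁, hρ₂, -, hρ₂0, hlim, hρ⟩ := hf
  have hR2 := hρ₂0 R hR
  let t := ε / (ρ₂ R ^ 2 + 1)
  have ht : 0 < t := by positivity
  -- The `+ 1` makes the norm at least 1, so that its square is at least `1 / (t * ε)` too; then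
  -- `exp s ≥ 1 + s` finishes.
  obtain ⟨S₀, hS₀⟩ := (hlim.eventually_ge_atTop (max 0 (1 / t * (1 / ε)) + 1)).exists_forall_of_atTop
  refine ⟨t, max S₀ (2 * R), ht.le, le_max_right _ _, fun a b hab => ?_, fun a b hab => ?_⟩
  · have h₁ : ‖f a - f b‖ ≤ ρ₂ R := by
      rw [← dist_eq_norm]
      exact (hρ a b).2.trans (hρ₂ dist_nonneg hR hab)
    have h₂ : t * ‖f a - f b‖ ^ 2 ≤ ε := by
      calc t * ‖f a - f b‖ ^ 2 ≤ t * (ρ₂ R ^ 2 + 1) := by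
            gcongr
            nlinarith [norm_nonneg (f a - f b)]
        _ = ε := by
            simp only [t]
            field_simp
    linarith [Real.add_one_le_exp (-(t * ‖f a - f b‖ ^ 2))]
  · have h₁ : 1 / t * (1 / ε) + 1 ≤ ‖f a - f b‖ := by
      rw [← dist_eq_norm]
      have := hS₀ _ ((le_max_left _ _).trans hab)
      linarith [(hρ a b).1, le_max_right 0 (1 / t * (1 / ε))]
    have h₀ : 0 < 1 / t * (1 / ε) := by positivity
    have h₂ : 1 / ε ≤ t * ‖f a - f b‖ ^ 2 := by
      calc 1 / ε = t * (1 / t * (1 / ε)) := by field_simp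
        _ ≤ t * ‖f a - f b‖ ^ 2 := by
          gcongr
          nlinarith
    rw [Real.exp_neg, inv_le_comm₀ (Real.exp_pos _) hε, ← one_div]
    linarith [Real.add_one_le_exp (t * ‖f a - f b‖ ^ 2)]

end Scales

/-! ### Assembling the scales into one coarse embedding. -/

section CoarseEmbedding

/-- A map with bounded displacement at every scale, under which points at large distance have
distant images, is a coarse embedding. -/
theorem IsCoarseEmbedding.of_bounds {Y : Type u} {Z : Type v} [Dist Y] [PseudoMetricSpace Z]
    (hY : ∀ y y' : Y, 0 ≤ dist y y') {F : Y → Z}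
    (hupper : ∀ R, ∃ M, ∀ y y', dist y y' ≤ R → dist (F y) (F y') ≤ M)
    (hlower : ∀ M, ∃ S, ∀ y y', S ≤ dist y y' → M ≤ dist (F y) (F y')) :
    IsCoarseEmbedding F := by
  let U : ℝ → Set ℝ := fun t => {r | ∃ y y', dist y y' ≤ t ∧ dist (F y) (F y') = r}
  -- Adding `Set.Ici t` keeps the set nonempty, since `sInf ∅ = 0` would spoil the lower control
  -- function when distances in `Y` are bounded.
  let V : ℝ → Set ℝ := fun t => {r | ∃ y y', t ≤ dist y y' ∧ dist (F y) (F y') = r} ∪ Set.Ici t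
  have hU : ∀ t, BddAbove (insert 0 (U t)) := by
    intro t
    obtain ⟨M, hM⟩ := hupper t
    refine BddAbove.insert _ ⟨M, ?_⟩
    rintro _ ⟨y, y', h, rfl⟩
    exact hM y y' h
  have hV : ∀ t, 0 ≤ t → 0 ∈ lowerBounds (V t) := by
    rintro t ht r (⟨y, y', -, rfl⟩ | hr)
    · exact dist_nonneg
    · exact ht.trans hr
  have hVne : ∀ t, (V t).Nonempty := fun t => ⟨t, Or.inr Set.self_mem_Ici⟩
  refine ⟨fun t => sInf (V t), fun t => sSup (insert 0 (U t)), fun s hs t _ hst => ?_,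
    fun s _ t _ hst => ?_, fun t ht => le_csInf (hVne t) (hV t ht),
    fun t _ => le_csSup (hU t) (Set.mem_insert _ _), ?_, fun y y' => ⟨?_, ?_⟩⟩
  · refine csInf_le_csInf ⟨0, hV s hs⟩ (hVne t) ?_
    rintro r (⟨y, y', h, rfl⟩ | hr)
    · exact Or.inl ⟨y, y', hst.trans h, rfl⟩
    · exact Or.inr (hst.trans hr)
  · refine csSup_le_csSup (hU t) (Set.insert_nonempty _ _) (Set.insert_subset_insert ?_)
    rintro r ⟨y, y', h, rfl⟩
    exact ⟨y, y', h.trans hst, rfl⟩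
  · refine tendsto_atTop.mpr fun M => ?_
    obtain ⟨S, hS⟩ := hlower M
    filter_upwards [eventually_ge_atTop S, eventually_ge_atTop M] with t hSt hMt
    refine le_csInf (hVne t) ?_
    rintro r (⟨y, y', h, rfl⟩ | hr)
    · exact hS y y' (hSt.trans h)
    · exact hMt.trans hr
  · exact csInf_le ⟨0, hV _ (hY y y')⟩ (Or.inl ⟨y, y', le_rfl, rfl⟩)
  · exact le_csSup (hU _) (Or.inr ⟨y, y', le_rfl, rfl⟩)

/-- Maps into Hilbert spaces whose displacements are square-summable, uniformly at every scale,
assemble to a map into the Hilbert sum. -/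
theorem CoarselyEmbedsIntoHilbert.of_seq {Y : Type u} [Dist Y] (hY : ∀ y y' : Y, 0 ≤ dist y y')
    {E : ℕ → Type v} [∀ n, NormedAddCommGroup (E n)] [∀ n, InnerProductSpace ℝ (E n)]
    [∀ n, CompleteSpace (E n)] (Φ : ∀ n, Y → E n)
    (hupper : ∀ R, ∃ b : ℕ → ℝ, Summable b ∧
      ∀ y y', dist y y' ≤ R → ∀ n, ‖Φ n y - Φ n y'‖ ^ 2 ≤ b n)
    (hlower : ∀ M, ∃ S, ∀ y y', S ≤ dist y y' →
      ∃ s : Finset ℕ, M ≤ ∑ n ∈ s, ‖Φ n y - Φ n y'‖ ^ 2) :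
    CoarselyEmbedsIntoHilbert.{u, v} Y := by
  rcases isEmpty_or_nonempty Y with hY0 | ⟨⟨y₀⟩⟩
  · refine ⟨E 0, inferInstance, inferInstance, inferInstance, Φ 0, ?_⟩
    exact .of_bounds hY (fun R => ⟨0, fun y => hY0.elim y⟩) fun M => ⟨0, fun y => hY0.elim y⟩
  have hmem : ∀ y, Memℓp (fun n => Φ n y - Φ n y₀) 2 := by
    intro y
    obtain ⟨b, hb, hle⟩ := hupper (dist y y₀)
    refine memℓp_gen ?_
    simp only [ENNReal.toReal_ofNat, Real.rpow_ofNat]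
    exact hb.of_nonneg_of_le (fun n => by positivity) (hle y y₀ le_rfl)
  -- Only differences are square-summable, hence the subtraction of a base point.
  let F : Y → lp E 2 := fun y => ⟨fun n => Φ n y - Φ n y₀, hmem y⟩
  have hF : ∀ y y' n, (F y - F y') n = Φ n y - Φ n y' := by
    intro y y' n
    change (Φ n y - Φ n y₀) - (Φ n y' - Φ n y₀) = _
    abel
  have h2 : 0 < (2 : ℝ≥0∞).toReal := by norm_num
  have hnorm : ∀ y y', dist (F y) (F y') ^ 2 = ∑' n, ‖Φ n y - Φ n y'‖ ^ 2 := by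
    intro y y'
    have h := lp.norm_rpow_eq_tsum h2 (F y - F y')
    simp only [ENNReal.toReal_ofNat, Real.rpow_ofNat, hF] at h
    rw [dist_eq_norm, h]
  refine ⟨lp E 2, inferInstance, inferInstance, inferInstance, F,
    .of_bounds hY (fun R => ?_) fun M => ?_⟩
  · obtain ⟨b, hb, hle⟩ := hupper R
    refine ⟨√(∑' n, b n), fun y y' h => Real.le_sqrt_of_sq_le ?_⟩
    rw [hnorm]
    exact (hb.of_nonneg_of_le (fun n => by positivity) (hle y y' h)).tsum_le_tsum (hle y y' h) hb
  · obtain ⟨S, hS⟩ := hlower (M ^ 2)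
    refine ⟨S, fun y y' h => ?_⟩
    obtain ⟨s, hs⟩ := hS y y' h
    obtain ⟨b, hb, hle⟩ := hupper (dist y y')
    refine le_of_sq_le_sq ?_ dist_nonneg
    rw [hnorm]
    exact hs.trans ((hb.of_nonneg_of_le (fun n => by positivity) (hle y y' le_rfl)).sum_le_tsum _
      fun n _ => by positivity)

/-- The far threshold obtained from `T n` serves as `T (n + 1)`, so only distances strictly between
consecutive scales stay uncontrolled. -/
theorem IsCoarseEmbedding.exists_gaussian_scales {X : Type u} [MetricSpace X] {H : Type v}
    [NormedAddCommGroup H] {f : X → H} (hf : IsCoarseEmbedding f) {ε : ℕ → ℝ}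
    (hε : ∀ n, 0 < ε n) :
    ∃ t T : ℕ → ℝ, (∀ n, 0 ≤ t n) ∧ (∀ n, 2 ^ n ≤ T n) ∧ (∀ n, 2 * T n ≤ T (n + 1)) ∧
      (∀ n a b, dist a b ≤ T n → 1 - ε n ≤ Real.exp (-(t n * ‖f a - f b‖ ^ 2))) ∧
      ∀ n a b, T (n + 1) ≤ dist a b → Real.exp (-(t n * ‖f a - f b‖ ^ 2)) ≤ ε n := by
  have h := fun (n : ℕ) (R : {R : ℝ // 0 ≤ R}) => hf.exists_gaussian_scale R.2 (hε n)
  choose t S ht hS hnear hfar using h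
  let T : ℕ → {R : ℝ // 0 ≤ R} := fun n =>
    Nat.rec ⟨1, zero_le_one⟩ (fun n R => ⟨S n R, (by linarith [R.2] : 0 ≤ 2 * R.1).trans (hS n R)⟩) n
  refine ⟨fun n => t n (T n), fun n => (T n).1, fun n => ht _ _, fun n => ?_, fun n => hS n (T n),
    fun n => hnear n (T n), fun n => hfar n (T n)⟩
  induction n with
  | zero => simp [T]
  | succ n ih =>
    have := hS n (T n)
    rw [pow_succ]
    change _ ≤ S n (T n)
    linarith

end CoarseEmbedding

/-! ### The main theorem. -/

theorem theorem2 {X : Type u} [MetricSpace X] [MeasurableSpace X] [BorelSpace X]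
    (hX : CoarselyEmbedsIntoHilbert.{u, v} X) (k : ℕ) (hk : 0 < k) :
    CoarselyEmbedsIntoHilbert.{u, u} (EmpiricalSpace X k) := by
  classical
  obtain ⟨H, _, _, _, f, hf⟩ := hX
  have hk' : (0 : ℝ) < k := by exact_mod_cast hk
  -- Summable for the upper bound, and with `4 * k * ε n ≤ 1` for the lower one.
  let ε : ℕ → ℝ := fun n => (1 / (4 * k)) * (1 / 2) ^ n
  have hε : ∀ n, 0 < ε n := fun n => by positivity
  have hεk : ∀ n, 4 * k * ε n ≤ 1 := by
    intro n
    have : 4 * k * ε n = (1 / 2) ^ n := by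
      simp only [ε]
      field_simp
    rw [this]
    exact pow_le_one₀ (by norm_num) (by norm_num)
  have hεsum : Summable ε := summable_geometric_two.mul_left _
  obtain ⟨t, T, ht, hTpow, hTT, hnear, hfar⟩ := hf.exists_gaussian_scales hε
  have hT0 : ∀ n, 0 < T n := fun n => lt_of_lt_of_le (by positivity) (hTpow n)
  have hTmono : Monotone T := monotone_nat_of_le_succ fun n => by linarith [hTT n, hT0 n]
  have hTlim : Tendsto T atTop atTop :=
    tendsto_atTop_mono hTpow (tendsto_pow_atTop_atTop_of_one_lt one_lt_two)
  choose E _ _ _ φ hφ using fun n => (posSemidef_gaussian f (ht n)).exists_inner_eq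
  simp only [Matrix.of_apply] at hφ
  have hφ1 : ∀ n a, ‖φ n a‖ = 1 := by
    intro n a
    have h := hφ n a a
    rw [real_inner_self_eq_norm_sq] at h
    rw [← sq_eq_sq₀ (norm_nonneg _) zero_le_one, h]
    simp
  have hφ0 : ∀ n a b, 0 ≤ inner ℝ (φ n a) (φ n b) := fun n a b => by
    rw [hφ]
    positivity
  simp only [← hφ] at hnear hfar
  choose x hx using fun α : EmpiricalSpace X k => α.2
  have hdist : ∀ α β : EmpiricalSpace X k,
      dist α β = wassersteinOne (empiricalMeasure (x α)) (empiricalMeasure (x β)) := by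
    intro α β
    rw [← hx, ← hx]
    rfl
  refine .of_seq (fun α β => ENNReal.toReal_nonneg) (fun n α => ∑ i, φ n (x α i))
    (fun R => ?_) fun M => ?_
  -- `W₁ ≤ R < R + 1` yields a matching with displacement below `k * (R + 1)`, which `T n` exceeds
  -- or equals from `m` on.
  · obtain ⟨m, hm⟩ := (hTlim.eventually_ge_atTop (k * (R + 1))).exists_forall_of_atTop
    refine ⟨fun n => (if n ∈ Finset.range m then (2 * k : ℝ) ^ 2 else 0) + k ^ 2 * (2 * ε n),
      Summable.add (summable_of_ne_finset_zero (s := Finset.range m) fun n hn => if_neg hn)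
        ((hεsum.mul_left 2).mul_left _), fun α β hαβ n => ?_⟩
    have hεn := hε n
    obtain ⟨σ, hσ⟩ := exists_perm_of_wassersteinOne_lt hk (x α) (x β) (t := k * (R + 1)) (by
      rw [← hdist, mul_div_cancel_left₀ _ hk'.ne']
      linarith)
    dsimp only
    split_ifs with hn
    · refine (norm_sum_sub_sum_sq_le_four (hφ1 n) (x α) (x β)).trans ?_
      have : 0 ≤ (k : ℝ) ^ 2 * (2 * ε n) := by positivity
      linarith
    · rw [zero_add]
      refine norm_sum_sub_sum_sq_le (hφ1 n) (hnear n) (x α) (x β) σ fun i => ?_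
      exact (hσ i).le.trans (hm n (by simpa using hn))
  · obtain ⟨m, hm⟩ := exists_nat_ge (4 * M)
    let ι := (Fin k ⊕ Fin k) × (Fin k ⊕ Fin k)
    -- At most `Fintype.card ι` scales are bad, so at least `m ≥ 4 * M` of the first `N` are good,
    -- each contributing `(1 / 2) ^ 2`.
    let N := m + Fintype.card ι
    refine ⟨T N + 1, fun α β hαβ => ?_⟩
    let d : ι → ℝ := fun p =>
      dist (Sum.elim (x α) (x β) p.1) (Sum.elim (x α) (x β) p.2)
    let P : ℕ → Prop := fun n => ∃ p, T n ≤ d p ∧ d p < T (n + 1)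
    have hσ : ∀ n ≤ N, ¬ ∃ σ : Equiv.Perm (Fin k), ∀ i, dist (x α i) (x β (σ i)) < T n := by
      rintro n hn ⟨σ, hσ⟩
      have h := wassersteinOne_le_of_perm (x α) (x β) σ (hT0 N).le
        fun i => (hσ i).le.trans (hTmono hn)
      rw [← hdist] at h
      linarith
    refine ⟨(Finset.range N).filter fun n => ¬ P n, ?_⟩
    have hcard : m ≤ ((Finset.range N).filter fun n => ¬ P n).card := by
      have h₁ := Finset.card_filter_add_card_filter_not (s := Finset.range N) P
      have h₂ : ((Finset.range N).filter P).card ≤ Fintype.card ι :=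
        card_filter_exists_mem_Ico_le hTmono d _
      rw [Finset.card_range] at h₁
      omega
    calc M ≤ m * (1 / 2) ^ 2 := by linarith
      _ ≤ ((Finset.range N).filter fun n => ¬ P n).card * (1 / 2) ^ 2 := by gcongr
      _ = ∑ n ∈ (Finset.range N).filter fun n => ¬ P n, (1 / 2 : ℝ) ^ 2 := by simp
      _ ≤ _ := by
        refine Finset.sum_le_sum fun n hn => ?_
        obtain ⟨hnN, hnP⟩ := Finset.mem_filter.mp hn
        gcongr
        refine half_le_norm_sum_sub_sum (hφ1 n) (hφ0 n) (hT0 n) (hTT n) (hnear n) (hfar n)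
          (hεk n) (x α) (x β) (fun p q hpq => ?_) (hσ n (Finset.mem_range.mp hnN).le)
        by_contra h
        exact hnP ⟨(p, q), not_lt.mp h, hpq⟩
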